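/- Let $1/2<p_0<1$ and $0<\epsilon<(\log p_0-\log(1-p_0))\min(p_0-\tfrac12,\,1-p_0)$, put $p=(p_0,1-p_0)$, and let $W_k$ be a word of $k$ i.i.d. letters from $\{0,1\}$ with distribution $p$. For probability vectors $l$ on $\{0,1\}$ write $h(l)=-\sum_a l_a\log l_a$ and $D(l\|p)=-\sum_a l_a\log(p_a/l_a)$ (natural logarithms, $0\log 0=0$). The specific Shannon entropy of the source, $\lim_{k\to\infty}-\frac1k\sum_w P(W_k=w)\log P(W_k=w)$, exists and equals $h(p)$, and the typical set is $$T^\epsilon_k=\{w\in\{0,1\}^k: e^{-k(h(p)+\epsilon)}\le P(W_k=w)\le e^{-k(h(p)-\epsilon)}\}.$$ It has positive probability for all sufficiently large $k$. For such $k$ let $W^\epsilon_k$ have the law of $W_k$ conditioned on $W_k\in T^\epsilon_k$, and let $U^\epsilon_k$ be uniform on $T^\epsilon_k$. For a random word $X_k$ of length $k$, its Guesswork is $G(X_k)$, where $G$ is any bijection $\{0,1\}^k\to\{1,\dots,2^k\}$ with $G(w')<G(w)$ whenever $P(X_k=w')>P(X_k=w)$; thus $G(W^\epsilon_k)$ and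 $G(U^\epsilon_k)$ each use a guessing order that is optimal for their own law. Then the following hold. 1. The problems of maximizing $h(l)$ over probability vectors $l$ subject to $h(l)+D(l\|p)-\epsilon=h(p)$, respectively $h(l)+D(l\|p)+\epsilon=h(p)$, have unique solutions $l^-$, respectively $l^+$, given by $$l^-_0=p_0-\frac{\epsilon}{\log p_0-\log(1-p_0)},\qquad l^+_0=p_0+\frac{\epsilon}{\log p_0-\log(1-p_0)},$$ and $1/2<l^-_0<p_0<l^+_0<1$. 2. For every choice of the guessing orders, $\lim_{k\to\infty}\frac1k\log E\,G(U^\epsilon_k)=h(l^-)$, and the limit $\Lambda_{W^\epsilon}(1)=\lim_{k\to\infty}\frac1k\log E\big(e^{\log G(W^\epsilon_k)}\big)=\lim_{k\to\infty}\frac1k\log E\,G(W^\epsilon_k)$ exists and equals $$\Lambda_{W^\epsilon}(1)=\begin{cases}2\log\big(p_0^{1/2}+(1-p_0)^{1/2}\big)&\text{if }\eta(1)\le h(p)+\epsilon,\\ h(l^-)-D(l^-\|p)&\text{if }\eta(1)>h(p)+\epsilon,\end{cases}\qquad \eta(1)=-\frac{\sum_a p_a^{1/2}\log p_a}{\sum_b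 p_b^{1/2}}.$$ Moreover $\Lambda_{W^\epsilon}(1)<h(l^-)$. 3. For every choice of the guessing orders, $\lim_{k\to\infty}\frac1k E\log G(U^\epsilon_k)=h(l^-)$ and $\lim_{k\to\infty}\frac1k E\log G(W^\epsilon_k)=h(p)$, and $h(p)<h(l^-)$. -/

import Mathlib

open Filter Topology

namespace Guesswork

noncomputable section

/-- The Shannon entropy `h(l) = -∑ l_a log l_a` (natural logarithm, `0 log 0 = 0`). -/
def entropy {A : Type*} [Fintype A] (l : A → ℝ) : ℝ :=
  -∑ a, l a * Real.log (l a)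

/-- The relative entropy `D(l‖p) = -∑ l_a log (p_a / l_a)`, used for `p` with positive entries. -/
def relEntropy {A : Type*} [Fintype A] (l p : A → ℝ) : ℝ :=
  -∑ a, l a * Real.log (p a / l a)

/-- `l ∈ argmax {h(l) : l a probability vector, h(l) + D(l‖p) - ε = h(p)}`. -/
def IsLMinus {A : Type*} [Fintype A] (p : A → ℝ) (ε : ℝ) (l : A → ℝ) : Prop :=
  l ∈ {l ∈ stdSimplex ℝ A | entropy l + relEntropy l p - ε = entropy p} ∧
    IsMaxOn entropy {l ∈ stdSimplex ℝ A | entropy l + relEntropy l p - ε = entropy p} l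

/-- `l ∈ argmax {h(l) : l a probability vector, h(l) + D(l‖p) + ε = h(p)}`. -/
def IsLPlus {A : Type*} [Fintype A] (p : A → ℝ) (ε : ℝ) (l : A → ℝ) : Prop :=
  l ∈ {l ∈ stdSimplex ℝ A | entropy l + relEntropy l p + ε = entropy p} ∧
    IsMaxOn entropy {l ∈ stdSimplex ℝ A | entropy l + relEntropy l p + ε = entropy p} l

/-- The tilted distribution `l^W_a(α) = p_a^(1/(1+α)) / ∑_b p_b^(1/(1+α))`, for `α > -1`. -/
def tilted {A : Type*} [Fintype A] (p : A → ℝ) (α : ℝ) (a : A) : ℝ :=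
  p a ^ (1 / (1 + α)) / ∑ b, p b ^ (1 / (1 + α))

/-- `η(α) = -∑_a l^W_a(α) log p_a`. -/
def eta {A : Type*} [Fintype A] (p : A → ℝ) (α : ℝ) : ℝ :=
  -∑ a, tilted p α a * Real.log (p a)

/-- A source over the alphabet `A`, given by the probability mass function of its word of
length `k`, for each `k`. -/
abbrev Source (A : Type*) := (k : ℕ) → (Fin k → A) → ℝ

/-- The source `W` whose letters are i.i.d. with distribution `p`. -/
def iidSource {A : Type*} (p : A → ℝ) : Source A :=
  fun _ w => ∏ i, p (w i)

/-- `H` is the specific Shannon entropy of the source `μ`. -/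
def HasSpecificEntropy {A : Type*} [Fintype A] (μ : Source A) (H : ℝ) : Prop :=
  Tendsto (fun k : ℕ => -((1 / (k : ℝ)) * ∑ w, μ k w * Real.log (μ k w))) atTop (𝓝 H)

open Classical in
/-- The typical set `T^ε_k` of a source `μ` with specific Shannon entropy `H`. -/
def typicalSet {A : Type*} [Fintype A] (μ : Source A) (H ε : ℝ) (k : ℕ) :
    Finset (Fin k → A) :=
  {w | Real.exp (-(k * (H + ε))) ≤ μ k w ∧ μ k w ≤ Real.exp (-(k * (H - ε)))}

open Classical in
/-- The source `W^ε`: the source `μ` conditioned on its typical set (a probability mass function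
for those `k` for which the typical set has positive probability). -/
def conditionedSource {A : Type*} [Fintype A] (μ : Source A) (H ε : ℝ) : Source A :=
  fun k w => if w ∈ typicalSet μ H ε k then μ k w / ∑ v ∈ typicalSet μ H ε k, μ k v else 0

open Classical in
/-- The source `U^ε`: the uniform distribution on the typical set of `μ` (a probability mass
function for those `k` for which the typical set is not empty). -/
def uniformSource {A : Type*} [Fintype A] (μ : Source A) (H ε : ℝ) : Source A :=
  fun k w => if w ∈ typicalSet μ H ε k then 1 / ((typicalSet μ H ε k).card : ℝ) else 0

/-- `G` is an optimal guessing order for the mass function `q`: a numbering of all the words by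
`1, …, |Ω|` that guesses strictly more likely words strictly earlier (ties broken arbitrarily). -/
def IsGuesswork {Ω : Type*} [Fintype Ω] (q : Ω → ℝ) (G : Ω → ℕ) : Prop :=
  Function.Injective G ∧ (∀ w, 1 ≤ G w ∧ G w ≤ Fintype.card Ω) ∧
    ∀ w w', q w < q w' → G w' < G w

/-- The expectation `E f(X)` for `X` with mass function `q`. -/
def expect {Ω : Type*} [Fintype Ω] (q : Ω → ℝ) (f : Ω → ℝ) : ℝ :=
  ∑ w, q w * f w

/-- The scaled cumulant generating function of `k⁻¹ log G(X_k)` exists at `α` and is `L`, where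
`X` is the source `μ` and `G k` is the guessing order for words of length `k`. -/
def HasSCGF {A : Type*} [Fintype A] (μ : Source A) (G : (k : ℕ) → (Fin k → A) → ℕ)
    (α L : ℝ) : Prop :=
  Tendsto (fun k : ℕ => (1 / (k : ℝ)) *
    Real.log (expect (μ k) fun w => Real.exp (α * Real.log (G k w)))) atTop (𝓝 L)

/-- `lim_k k⁻¹ log E(G(X_k)) = L`. -/
def HasGuessworkRate {A : Type*} [Fintype A] (μ : Source A) (G : (k : ℕ) → (Fin k → A) → ℕ)
    (L : ℝ) : Prop :=
  Tendsto (fun k : ℕ => (1 / (k : ℝ)) * Real.log (expect (μ k) fun w => (G k w : ℝ)))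
    atTop (𝓝 L)

/-- `lim_k k⁻¹ E(log G(X_k)) = L`. -/
def HasLogGuessworkRate {A : Type*} [Fintype A] (μ : Source A)
    (G : (k : ℕ) → (Fin k → A) → ℕ) (L : ℝ) : Prop :=
  Tendsto (fun k : ℕ => (1 / (k : ℝ)) * expect (μ k) fun w => Real.log (G k w))
    atTop (𝓝 L)

/-- The distribution `(x, 1 - x)` on the binary alphabet. -/
def binary (x : ℝ) : Fin 2 → ℝ := ![x, 1 - x]

end

end Guesswork

/-! No large deviation principle is needed: two elementary facts about an optimal order on N words
carry everything. A word `w` is guessed no later than the number of words at least as likely, and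
the reciprocals of the ranks sum to a harmonic number, at most 1 + log N. The first bounds E log G
by the Shannon entropy and E G by (∑ √q)². The second, through Gibbs' inequality and Cauchy-Schwarz,
gives the reverse bounds up to a term log(1 + log N), respectively a factor 1 + log N. For words of
length k these errors vanish after taking (1/k) log.

It remains to find the growth of the entropy and of ∑ √q for the two laws. The probability of a word
depends only on its number n of zeros, and with d = ε / (log p₀ - log(1 - p₀)) typicality means k(p₀
- d) ≤ n ≤ k(p₀ + d). So the size of the typical set, and the sum of √P over it, are binomial sums
over a window (`binomial_window_rate`). Their rate is the maximum over y in the window of the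
concave function binEntropy y + y log a + (1 - y) log b. For the size (a = b = 1) it sits at the
left end p₀ - d > 1/2. For the square roots the unconstrained maximizer is the tilted weight t < p₀,
so the maximizer is x = max t (p₀ - d); the two cases of Λ say which of the two wins. Then Λ = h(x)
- D(x‖p) < h(x) ≤ h(l⁻). Finally, the typical set has probability tending to 1 by Chebyshev, so
conditioning on it leaves the entropy rate h(p) unchanged. -/

namespace Guesswork

/-! ### Optimal guessing orders: one-shot bounds by entropy and by (∑ √q)². -/

section Order

variable {Ω : Type*} [Fintype Ω] {q : Ω → ℝ} {G : Ω → ℕ}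

theorem IsGuesswork.image_eq (hG : IsGuesswork q G) :
    Finset.univ.image G = Finset.Icc 1 (Fintype.card Ω) := by
  apply Finset.eq_of_subset_of_card_le
  · intro n hn
    obtain ⟨w, -, rfl⟩ := Finset.mem_image.1 hn
    exact Finset.mem_Icc.2 (hG.2.1 w)
  · rw [Finset.card_image_of_injective _ hG.1]
    simp

theorem IsGuesswork.pos (hG : IsGuesswork q G) (w : Ω) : (0 : ℝ) < G w := by
  exact_mod_cast (hG.2.1 w).1

/-- A word is guessed no later than the number of words which are at least as likely. -/
theorem IsGuesswork.le_card (hG : IsGuesswork q G) (w : Ω) :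
    G w ≤ (Finset.univ.filter fun v => q w ≤ q v).card := by
  classical
  have h1 : Finset.Icc 1 (G w) ⊆ (Finset.univ.filter fun v => q w ≤ q v).image G := by
    intro n hn
    have hn' := Finset.mem_Icc.1 hn
    have : n ∈ Finset.univ.image G := by
      rw [hG.image_eq]
      exact Finset.mem_Icc.2 ⟨hn'.1, hn'.2.trans (hG.2.1 w).2⟩
    obtain ⟨v, -, rfl⟩ := Finset.mem_image.1 this
    refine Finset.mem_image.2 ⟨v, ?_, rfl⟩
    simp only [Finset.mem_filter, Finset.mem_univ, true_and]
    by_contra! hlt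
    exact absurd (hG.2.2 v w hlt) (by omega)
  simpa using (Finset.card_le_card h1).trans Finset.card_image_le

/-- The ranks are exactly 1, …, N, so the sum is the N-th harmonic number. -/
theorem IsGuesswork.sum_inv_le (hG : IsGuesswork q G) :
    ∑ w, (G w : ℝ)⁻¹ ≤ 1 + Real.log (Fintype.card Ω) := by
  classical
  have h : ∑ w, (G w : ℝ)⁻¹ = ((harmonic (Fintype.card Ω) : ℚ) : ℝ) := by
    rw [harmonic_eq_sum_Icc, ← hG.image_eq, Finset.sum_image (fun a _ b _ h => hG.1 h)]
    push_cast
    rfl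
  rw [h]
  exact harmonic_le_one_add_log _

/-- Words at least as likely as `w` have total mass at most 1, hence G(w) q(w) ≤ 1. -/
theorem IsGuesswork.expect_log_le (hG : IsGuesswork q G) (h0 : ∀ w, 0 ≤ q w)
    (h1 : ∑ w, q w = 1) :
    expect q (fun w => Real.log (G w)) ≤ -∑ w, q w * Real.log (q w) := by
  unfold expect
  rw [← Finset.sum_neg_distrib]
  refine Finset.sum_le_sum fun w _ => ?_
  rcases (h0 w).eq_or_lt with hw | hw
  · simp [← hw]
  have h2 : (G w : ℝ) * q w ≤ 1 := by
    calc (G w : ℝ) * q w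
        ≤ ((Finset.univ.filter fun v => q w ≤ q v).card : ℝ) * q w := by
          gcongr; exact hG.le_card w
      _ = ∑ v with q w ≤ q v, q w := by simp
      _ ≤ ∑ v with q w ≤ q v, q v :=
          Finset.sum_le_sum fun v hv => (Finset.mem_filter.1 hv).2
      _ ≤ ∑ v, q v :=
          Finset.sum_le_sum_of_subset_of_nonneg (Finset.filter_subset _ _) fun v _ _ => h0 v
      _ = 1 := h1
  have h3 : Real.log (G w) + Real.log (q w) ≤ 0 := by
    rw [← Real.log_mul (hG.pos w).ne' hw.ne']
    exact Real.log_nonpos (mul_nonneg (hG.pos w).le hw.le) h2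
  nlinarith

/-- Gibbs' inequality against the law proportional to 1/G, whose normalizer is at most 1 + log N. -/
theorem IsGuesswork.entropy_le (hG : IsGuesswork q G) [Nonempty Ω] (h0 : ∀ w, 0 ≤ q w)
    (h1 : ∑ w, q w = 1) :
    -∑ w, q w * Real.log (q w) ≤
      expect q (fun w => Real.log (G w)) + Real.log (1 + Real.log (Fintype.card Ω)) := by
  set Z := ∑ w, (G w : ℝ)⁻¹ with hZ
  have hZ0 : 0 < Z := Finset.sum_pos (fun w _ => inv_pos.2 (hG.pos w)) Finset.univ_nonempty
  have key : ∀ w, -(q w * Real.log (q w)) - q w * Real.log (G w) - q w * Real.log Z ≤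
      (G w : ℝ)⁻¹ / Z - q w := by
    intro w
    have hGw := hG.pos w
    rcases (h0 w).eq_or_lt with hw | hw
    · simp only [← hw]
      have : 0 ≤ (G w : ℝ)⁻¹ / Z := by positivity
      simpa using this
    -- log u ≤ u - 1 at u = (1/(G Z)) / q, the likelihood ratio; weighted by q, the right sides sum
    -- to 0.
    have h := Real.log_le_sub_one_of_pos (x := (q w * G w * Z)⁻¹) (by positivity)
    rw [Real.log_inv, Real.log_mul (by positivity) hZ0.ne', Real.log_mul hw.ne' hGw.ne'] at h
    have h' := mul_le_mul_of_nonneg_left h hw.le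
    have e : q w * ((q w * G w * Z)⁻¹ - 1) = (G w : ℝ)⁻¹ / Z - q w := by
      field_simp
    rw [e] at h'
    linarith
  have hs := Finset.sum_le_sum fun w (_ : w ∈ Finset.univ) => key w
  simp only [Finset.sum_sub_distrib, Finset.sum_neg_distrib, ← Finset.sum_mul, ← Finset.sum_div,
    h1] at hs
  rw [← hZ, div_self hZ0.ne'] at hs
  have hl := Real.log_le_log hZ0 hG.sum_inv_le
  unfold expect
  linarith

/-- In q(w) G(w), count each word `v` at least as likely as `w` and use q(w) ≤ √q(w) √q(v). -/
theorem IsGuesswork.expect_le_sq_sum_sqrt (hG : IsGuesswork q G) (h0 : ∀ w, 0 ≤ q w) :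
    expect q (fun w => (G w : ℝ)) ≤ (∑ w, √(q w)) ^ 2 := by
  unfold expect
  rw [sq, Finset.sum_mul]
  refine Finset.sum_le_sum fun w _ => ?_
  calc q w * G w ≤ q w * ((Finset.univ.filter fun v => q w ≤ q v).card : ℝ) := by
        gcongr
        · exact h0 w
        · exact hG.le_card w
    _ = ∑ v with q w ≤ q v, √(q w) * √(q w) := by
        simp [Real.mul_self_sqrt (h0 w), mul_comm]
    _ ≤ ∑ v with q w ≤ q v, √(q w) * √(q v) :=
        Finset.sum_le_sum fun v hv => mul_le_mul_of_nonneg_left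
          (Real.sqrt_le_sqrt (Finset.mem_filter.1 hv).2) (Real.sqrt_nonneg _)
    _ ≤ ∑ v, √(q w) * √(q v) :=
        Finset.sum_le_sum_of_subset_of_nonneg (Finset.filter_subset _ _)
          fun v _ _ => by positivity
    _ = √(q w) * ∑ v, √(q v) := by rw [Finset.mul_sum]

/-- Cauchy-Schwarz for √q = √(q G) · √(1/G). -/
theorem IsGuesswork.sq_sum_sqrt_le (hG : IsGuesswork q G) (h0 : ∀ w, 0 ≤ q w) :
    (∑ w, √(q w)) ^ 2 ≤
      expect q (fun w => (G w : ℝ)) * (1 + Real.log (Fintype.card Ω)) := by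
  have hE : 0 ≤ expect q (fun w => (G w : ℝ)) :=
    Finset.sum_nonneg fun w _ => mul_nonneg (h0 w) (hG.pos w).le
  refine le_trans ?_ (mul_le_mul_of_nonneg_left hG.sum_inv_le hE)
  refine Finset.sum_sq_le_sum_mul_sum_of_sq_le_mul _
    (fun w _ => mul_nonneg (h0 w) (hG.pos w).le) (fun w _ => inv_nonneg.2 (hG.pos w).le)
    fun w _ => le_of_eq ?_
  rw [Real.sq_sqrt (h0 w), mul_assoc, mul_inv_cancel₀ (hG.pos w).ne', mul_one]

end Order

/-! ### From one-shot bounds to exponential rates. -/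

section Rates

/-- The harmonic factor 1 + k log|A| is invisible on the exponential scale. -/
theorem tendsto_log_one_add_mul_div {c : ℝ} (hc : 0 < c) :
    Tendsto (fun k : ℕ => (1 / (k : ℝ)) * Real.log (1 + k * c)) atTop (𝓝 0) := by
  have h1 : Tendsto (fun k : ℕ => 1 + (k : ℝ) * c) atTop atTop :=
    tendsto_atTop_add_const_left _ _ (tendsto_natCast_atTop_atTop.atTop_mul_const hc)
  have h2 := (Real.isLittleO_log_id_atTop.tendsto_div_nhds_zero).comp h1
  have h3 : Tendsto (fun k : ℕ => 1 / (k : ℝ) + c) atTop (𝓝 (0 + c)) :=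
    tendsto_one_div_atTop_nhds_zero_nat.add_const c
  have h4 := h2.mul h3
  rw [zero_mul] at h4
  refine h4.congr' ?_
  filter_upwards [eventually_gt_atTop 0] with k hk
  have hk' : (0 : ℝ) < k := by exact_mod_cast hk
  have : 0 < 1 + (k : ℝ) * c := by positivity
  simp only [Function.comp_apply, id]
  field_simp

variable {A : Type*} [Fintype A] {μ : Source A} {G : (k : ℕ) → (Fin k → A) → ℕ} {L : ℝ}

theorem log_card_words (k : ℕ) :
    Real.log (Fintype.card (Fin k → A)) = k * Real.log (Fintype.card A) := by
  simp

/-- The expected logarithm of the Guesswork grows like the entropy of the word. -/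
theorem hasLogGuessworkRate_of_entropy [Nontrivial A] (hG : ∀ k, IsGuesswork (μ k) (G k))
    (h0 : ∀ k w, 0 ≤ μ k w) (h1 : ∀ᶠ k in atTop, ∑ w, μ k w = 1)
    (hL : HasSpecificEntropy μ L) : HasLogGuessworkRate μ G L := by
  have hc : 0 < Real.log (Fintype.card A) :=
    Real.log_pos (by exact_mod_cast Fintype.one_lt_card)
  have hlow := hL.sub (tendsto_log_one_add_mul_div hc)
  rw [sub_zero] at hlow
  refine tendsto_of_tendsto_of_tendsto_of_le_of_le' hlow hL ?_ ?_
  · filter_upwards [h1] with k hk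
    have := (hG k).entropy_le (h0 k) hk
    rw [log_card_words] at this
    have hk0 : 0 ≤ 1 / (k : ℝ) := by positivity
    nlinarith [mul_le_mul_of_nonneg_left this hk0]
  · filter_upwards [h1] with k hk
    have := (hG k).expect_log_le (h0 k) hk
    have hk0 : 0 ≤ 1 / (k : ℝ) := by positivity
    nlinarith [mul_le_mul_of_nonneg_left this hk0]

/-- The expected Guesswork grows like `(∑ √μ) ^ 2`. -/
theorem hasGuessworkRate_of_sqrt [Nontrivial A] (hG : ∀ k, IsGuesswork (μ k) (G k))
    (h0 : ∀ k w, 0 ≤ μ k w) (h1 : ∀ᶠ k in atTop, 0 < ∑ w, √(μ k w))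
    (hL : Tendsto (fun k : ℕ => (1 / (k : ℝ)) * Real.log ((∑ w, √(μ k w)) ^ 2)) atTop (𝓝 L)) :
    HasGuessworkRate μ G L := by
  have hc : 0 < Real.log (Fintype.card A) :=
    Real.log_pos (by exact_mod_cast Fintype.one_lt_card)
  have hlow := hL.sub (tendsto_log_one_add_mul_div hc)
  rw [sub_zero] at hlow
  have hpos : ∀ᶠ k in atTop, 0 < expect (μ k) (fun w => (G k w : ℝ)) := by
    filter_upwards [h1] with k hk
    have h2 := (hG k).sq_sum_sqrt_le (h0 k)
    rw [log_card_words] at h2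
    have h3 : 0 < 1 + (k : ℝ) * Real.log (Fintype.card A) := by positivity
    exact pos_of_mul_pos_left ((pow_pos hk 2).trans_le h2) h3.le
  refine tendsto_of_tendsto_of_tendsto_of_le_of_le' hlow hL ?_ ?_
  · filter_upwards [h1, hpos] with k hk hE
    have h2 := (hG k).sq_sum_sqrt_le (h0 k)
    rw [log_card_words] at h2
    have h3 : 0 < 1 + (k : ℝ) * Real.log (Fintype.card A) := by positivity
    have h4 := Real.log_le_log (pow_pos hk 2) h2
    rw [Real.log_mul hE.ne' h3.ne'] at h4
    have hk0 : 0 ≤ 1 / (k : ℝ) := by positivity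
    nlinarith [mul_le_mul_of_nonneg_left h4 hk0]
  · filter_upwards [hpos] with k hE
    have hk0 : 0 ≤ 1 / (k : ℝ) := by positivity
    exact mul_le_mul_of_nonneg_left
      (Real.log_le_log hE ((hG k).expect_le_sq_sum_sqrt (h0 k))) hk0

theorem hasSCGF_one_iff (hG : ∀ k, IsGuesswork (μ k) (G k)) :
    HasSCGF μ G 1 L ↔ HasGuessworkRate μ G L := by
  unfold HasSCGF HasGuessworkRate
  have : ∀ k w, Real.exp (1 * Real.log (G k w)) = G k w := fun k w => by
    rw [one_mul, Real.exp_log ((hG k).pos w)]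
  simp only [this]

end Rates

/-! ### Binomial coefficients and sums on the exponential scale. -/

section Binomial

open Nat in
-- The Poisson weight n ^ j / j! is maximal in j at j = n.
theorem factorial_mul_pow_le (n j : ℕ) : n ! * n ^ j ≤ j ! * n ^ n := by
  rcases le_total n j with h | h
  · calc n ! * n ^ j = n ! * n ^ (j - n) * n ^ n := by
          rw [mul_assoc, ← pow_add, Nat.sub_add_cancel h]
      _ ≤ j ! * n ^ n := Nat.mul_le_mul_right _ (Nat.factorial_mul_pow_sub_le_factorial h)
  -- The factor `choose 0` is 1; the content is n! = j! · n(n-1)⋯(j+1).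
  · have h1 : n ! = (n - j).factorial.choose 0 * (j ! * n.descFactorial (n - j)) := by
      have := Nat.factorial_mul_descFactorial (Nat.sub_le n j)
      rw [Nat.sub_sub_self h] at this
      simpa using this.symm
    calc n ! * n ^ j = j ! * (n.descFactorial (n - j) * n ^ j) := by
          rw [h1]; simp [mul_assoc]
      _ ≤ j ! * (n ^ (n - j) * n ^ j) := by
          gcongr; exact Nat.descFactorial_le_pow _ _
      _ = j ! * n ^ n := by rw [← pow_add, Nat.sub_add_cancel h]

/-- The mode of the binomial distribution with parameters `n + m` and `n / (n + m)` is `n`. -/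
theorem choose_mul_pow_le (n m j i : ℕ) (h : j + i = n + m) :
    (n + m).choose j * (n ^ j * m ^ i) ≤ (n + m).choose n * (n ^ n * m ^ m) := by
  have e1 := Nat.add_choose_mul_factorial_mul_factorial n m
  have e2 := Nat.add_choose_mul_factorial_mul_factorial j i
  rw [← Nat.choose_symm_add] at e1 e2
  rw [h] at e2
  have h1 := Nat.mul_le_mul (factorial_mul_pow_le n j) (factorial_mul_pow_le m i)
  have hp : 0 < j.factorial * i.factorial * (n.factorial * m.factorial) := by positivity
  refine Nat.le_of_mul_le_mul_left ?_ hp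
  calc _ = ((n + m).choose j * j.factorial * i.factorial) *
        (n.factorial * n ^ j * (m.factorial * m ^ i)) := by ring
    _ ≤ ((n + m).choose j * j.factorial * i.factorial) *
        (j.factorial * n ^ n * (i.factorial * m ^ m)) := Nat.mul_le_mul_left _ h1
    _ = ((n + m).choose n * n.factorial * m.factorial) *
        (j.factorial * n ^ n * (i.factorial * m ^ m)) := by rw [e1, e2]
    _ = _ := by ring

/-- The binomial expansion has n + m + 1 terms, none larger than the modal one. -/
theorem pow_self_le_choose (n m : ℕ) :
    (n + m) ^ (n + m) ≤ (n + m + 1) * ((n + m).choose n * (n ^ n * m ^ m)) := by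
  rw [add_pow n m (n + m)]
  calc _ ≤ ∑ _j ∈ Finset.range (n + m + 1), (n + m).choose n * (n ^ n * m ^ m) := by
        refine Finset.sum_le_sum fun j hj => ?_
        have hj' : j ≤ n + m := by have := Finset.mem_range.1 hj; omega
        rw [mul_comm]
        exact choose_mul_pow_le n m j _ (by omega)
    _ = _ := by simp

theorem mul_binEntropy_div {k n : ℕ} (hk : 0 < k) (hn : n ≤ k) :
    (k : ℝ) * Real.binEntropy (n / k) =
      k * Real.log k - n * Real.log n - ((k - n : ℕ) : ℝ) * Real.log ((k - n : ℕ) : ℝ) := by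
  have hk' : (k : ℝ) ≠ 0 := by positivity
  have aux : ∀ m : ℕ, (k : ℝ) * Real.negMulLog (m / k) = m * Real.log k - m * Real.log m := by
    intro m
    rcases Nat.eq_zero_or_pos m with rfl | hm
    · simp
    · have hm' : (m : ℝ) ≠ 0 := by positivity
      rw [Real.negMulLog, Real.log_div hm' hk']
      field_simp
      ring
  have e : 1 - (n : ℝ) / k = ((k - n : ℕ) : ℝ) / k := by
    rw [Nat.cast_sub hn]; field_simp
  rw [Real.binEntropy_eq_negMulLog_add_negMulLog_one_sub, mul_add, e, aux, aux, Nat.cast_sub hn]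
  ring

theorem binEntropy_sub_le_log_choose {k n : ℕ} (hk : 0 < k) (hn : n ≤ k) :
    (k : ℝ) * Real.binEntropy (n / k) - Real.log (1 + k) ≤ Real.log (k.choose n) := by
  obtain ⟨m, rfl⟩ := Nat.exists_eq_add_of_le hn
  rw [mul_binEntropy_div hk hn, Nat.add_sub_cancel_left]
  have hpp : ∀ i : ℕ, (0 : ℝ) < (i : ℝ) ^ i := fun i => by
    rcases Nat.eq_zero_or_pos i with rfl | hi
    · simp
    · positivity
  have hc : (0 : ℝ) < (n + m).choose n := by
    exact_mod_cast Nat.choose_pos hn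
  have h : ((n + m : ℕ) : ℝ) ^ (n + m) ≤
      (1 + ((n + m : ℕ) : ℝ)) * (((n + m).choose n : ℝ) * ((n : ℝ) ^ n * (m : ℝ) ^ m)) := by
    rw [add_comm (1 : ℝ)]
    exact_mod_cast pow_self_le_choose n m
  have hl := Real.log_le_log (hpp _) h
  rw [Real.log_mul (by positivity) (mul_pos hc (mul_pos (hpp n) (hpp m))).ne',
    Real.log_mul hc.ne' (mul_pos (hpp n) (hpp m)).ne',
    Real.log_mul (hpp n).ne' (hpp m).ne', Real.log_pow, Real.log_pow, Real.log_pow] at hl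
  linarith

theorem binEntropy_eq_log (x : ℝ) :
    Real.binEntropy x = -(x * Real.log x + (1 - x) * Real.log (1 - x)) := by
  simp only [Real.binEntropy, Real.log_inv]
  ring

theorem sum_choose_mul_pow (x : ℝ) (k : ℕ) :
    ∑ n ∈ Finset.range (k + 1), (k.choose n : ℝ) * (x ^ n * (1 - x) ^ (k - n)) = 1 := by
  have := add_pow x (1 - x) k
  rw [add_sub_cancel, one_pow] at this
  exact (Finset.sum_congr rfl fun n _ => by ring).trans this.symm

theorem sum_choose_mul_pow_mul (x : ℝ) (k : ℕ) :
    ∑ n ∈ Finset.range (k + 1), (k.choose n : ℝ) * (x ^ n * (1 - x) ^ (k - n) * n) = k * x := by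
  have := congrArg (Polynomial.eval x) (bernsteinPolynomial.sum_smul ℝ k)
  simp only [bernsteinPolynomial, Polynomial.eval_finsetSum, nsmul_eq_mul, Polynomial.eval_mul,
    Polynomial.eval_natCast, Polynomial.eval_pow, Polynomial.eval_X, Polynomial.eval_sub,
    Polynomial.eval_one] at this
  rw [← this]
  exact Finset.sum_congr rfl fun n _ => by ring

theorem sum_choose_mul_pow_mul_sq (x : ℝ) (k : ℕ) :
    ∑ n ∈ Finset.range (k + 1), (k.choose n : ℝ) * (x ^ n * (1 - x) ^ (k - n) * (k * x - n) ^ 2) =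
      k * x * (1 - x) := by
  have := congrArg (Polynomial.eval x) (bernsteinPolynomial.variance ℝ k)
  simp only [bernsteinPolynomial, Polynomial.eval_finsetSum, nsmul_eq_mul, Polynomial.eval_mul,
    Polynomial.eval_natCast, Polynomial.eval_pow, Polynomial.eval_X, Polynomial.eval_sub,
    Polynomial.eval_one] at this
  rw [← this]
  exact Finset.sum_congr rfl fun n _ => by ring

open Classical in
/-- Exponential growth rate of a binomial sum `∑ C(k,n) a^n b^(k-n)` over the window
`k l ≤ n ≤ k u`, when its dominant terms are those with `n ≈ k x`. -/
theorem binomial_window_rate {a b x l u : ℝ} (ha : 0 < a) (hb : 0 < b) (hx0 : 0 < x)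
    (hxu : x < u) (hu : u ≤ 1) (hlx : l ≤ x)
    (hs : ∀ y, l ≤ y →
      (y - x) * (Real.log a - Real.log b - (Real.log x - Real.log (1 - x))) ≤ 0)
    (S : ℕ → ℝ) (hS : ∀ k : ℕ, S k = ∑ n ∈ Finset.range (k + 1), (k.choose n : ℝ) *
      (if k * l ≤ n ∧ n ≤ k * u then a ^ n * b ^ (k - n) else 0)) :
    (∀ᶠ k in atTop, 0 < S k) ∧
    Tendsto (fun k : ℕ => (1 / (k : ℝ)) * Real.log (S k)) atTop
      (𝓝 (Real.binEntropy x + x * Real.log a + (1 - x) * Real.log b)) := by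
  have hx1 : 0 < 1 - x := by linarith
  set V := Real.binEntropy x + x * Real.log a + (1 - x) * Real.log b with hV
  have hnk : Tendsto (fun k : ℕ => (⌈x * (k : ℝ)⌉₊ : ℝ) / k) atTop (𝓝 x) :=
    (tendsto_nat_ceil_mul_div_atTop hx0.le).comp tendsto_natCast_atTop_atTop
  -- Lower bound by the single term n = ⌈xk⌉. Rounding up respects the left end even when x = l; x <
  -- u leaves room on the right.
  have hlow : ∀ᶠ k : ℕ in atTop, 0 < k ∧ ⌈x * (k : ℝ)⌉₊ ≤ k ∧
      0 < (k.choose ⌈x * (k : ℝ)⌉₊ : ℝ) *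
        (a ^ ⌈x * (k : ℝ)⌉₊ * b ^ (k - ⌈x * (k : ℝ)⌉₊)) ∧
      (k.choose ⌈x * (k : ℝ)⌉₊ : ℝ) *
        (a ^ ⌈x * (k : ℝ)⌉₊ * b ^ (k - ⌈x * (k : ℝ)⌉₊)) ≤ S k := by
    filter_upwards [hnk.eventually_lt_const hxu, eventually_gt_atTop 0] with k hk hk0
    have hk' : (0 : ℝ) < k := by exact_mod_cast hk0
    have h1 : (⌈x * (k : ℝ)⌉₊ : ℝ) < k * u := by
      rw [div_lt_iff₀ hk'] at hk; linarith
    have h2 : ⌈x * (k : ℝ)⌉₊ ≤ k := by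
      have : (⌈x * (k : ℝ)⌉₊ : ℝ) ≤ k := by nlinarith
      exact_mod_cast this
    have h3 : k * l ≤ (⌈x * (k : ℝ)⌉₊ : ℝ) :=
      le_trans (by nlinarith) (Nat.le_ceil _)
    refine ⟨hk0, h2, ?_, ?_⟩
    · have : 0 < k.choose ⌈x * (k : ℝ)⌉₊ := Nat.choose_pos h2
      positivity
    · rw [hS]
      have := Finset.single_le_sum (f := fun n : ℕ => (k.choose n : ℝ) *
        (if k * l ≤ n ∧ n ≤ k * u then a ^ n * b ^ (k - n) else 0))
        (s := Finset.range (k + 1)) (fun n _ => by positivity)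
        (Finset.mem_range.2 (Nat.lt_succ_of_le h2))
      simpa only [h3, h1.le, and_self, if_true] using this
  -- Chernoff bound: each term in the window is at most e^(kV) times the binomial weight of
  -- parameter x. The logarithm of the ratio is affine in n and vanishes at n = kx, so `hs` at y = n
  -- / k is exactly what is required.
  have hup : ∀ k : ℕ, 0 < k → S k ≤ Real.exp (k * V) := by
    intro k hk0
    have hk' : (0 : ℝ) < k := by exact_mod_cast hk0
    rw [hS]
    calc _ ≤ ∑ n ∈ Finset.range (k + 1),
          (k.choose n : ℝ) * (x ^ n * (1 - x) ^ (k - n)) * Real.exp (k * V) := by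
          refine Finset.sum_le_sum fun n hn => ?_
          have hn' : n ≤ k := by have := Finset.mem_range.1 hn; omega
          rw [mul_assoc]
          refine mul_le_mul_of_nonneg_left ?_ (by positivity)
          split_ifs with hw
          · rw [← Real.log_le_log_iff (by positivity) (by positivity),
              Real.log_mul (by positivity) (by positivity),
              Real.log_mul (by positivity) (by positivity),
              Real.log_mul (by positivity) (by positivity), Real.log_exp, Real.log_pow,
              Real.log_pow, Real.log_pow, Real.log_pow, Nat.cast_sub hn', hV, binEntropy_eq_log]
            have h := hs (n / k) (by rw [le_div_iff₀ hk']; linarith [hw.1])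
            have h' := mul_le_mul_of_nonneg_left h hk'.le
            rw [← mul_assoc, mul_sub (k : ℝ) (n / k : ℝ), mul_div_cancel₀ _ hk'.ne'] at h'
            linarith
          · positivity
      _ = Real.exp (k * V) := by rw [← Finset.sum_mul, sum_choose_mul_pow, one_mul]
  have hpos : ∀ᶠ k in atTop, 0 < S k := hlow.mono fun k hk => hk.2.2.1.trans_le hk.2.2.2
  refine ⟨hpos, ?_⟩
  have hlim : Tendsto (fun k : ℕ => Real.binEntropy ((⌈x * (k : ℝ)⌉₊ : ℝ) / k) +
      (⌈x * (k : ℝ)⌉₊ : ℝ) / k * Real.log a + (1 - (⌈x * (k : ℝ)⌉₊ : ℝ) / k) * Real.log b -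
      (1 / (k : ℝ)) * Real.log (1 + k * 1)) atTop (𝓝 (V - 0)) :=
    ((((Real.binEntropy_continuous.tendsto x).comp hnk).add (hnk.mul_const _)).add
      ((hnk.const_sub 1).mul_const _)).sub (tendsto_log_one_add_mul_div one_pos)
  rw [sub_zero] at hlim
  refine tendsto_of_tendsto_of_tendsto_of_le_of_le' hlim tendsto_const_nhds ?_ ?_
  · filter_upwards [hlow] with k ⟨hk0, hn, hp, hle⟩
    have hk' : (0 : ℝ) < k := by exact_mod_cast hk0
    have h1 := Real.log_le_log hp hle
    have hcp : (0 : ℝ) < k.choose ⌈x * (k : ℝ)⌉₊ := by exact_mod_cast Nat.choose_pos hn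
    rw [Real.log_mul hcp.ne' (by positivity), Real.log_mul (by positivity) (by positivity),
      Real.log_pow, Real.log_pow, Nat.cast_sub hn] at h1
    have h2 := binEntropy_sub_le_log_choose hk0 hn
    rw [one_div, inv_mul_eq_div, inv_mul_eq_div, le_div_iff₀ hk', sub_mul, add_mul, add_mul,
      mul_right_comm, div_mul_cancel₀ _ hk'.ne', mul_right_comm (1 - _), sub_mul,
      div_mul_cancel₀ _ hk'.ne', div_mul_cancel₀ _ hk'.ne', mul_one]
    linarith
  · filter_upwards [hpos, eventually_gt_atTop 0] with k hk hk0
    have hk' : (0 : ℝ) < k := by exact_mod_cast hk0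
    have := Real.log_le_log hk (hup k hk0)
    rw [Real.log_exp] at this
    rw [one_div, inv_mul_eq_div, div_le_iff₀ hk']
    linarith

end Binomial

/-! ### Binary words grouped by their number of zeros. -/

section Words

/-- The number of occurrences of the letter `0` in a binary word. -/
def zeros {k : ℕ} (w : Fin k → Fin 2) : ℕ := (Finset.univ.filter fun i => w i = 0).card

theorem zeros_le {k : ℕ} (w : Fin k → Fin 2) : zeros w ≤ k :=
  (Finset.card_filter_le _ _).trans_eq (by simp)

/-- A word is determined by the set of positions of its zeros. -/
theorem sum_words (k : ℕ) (f : ℕ → ℝ) :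
    ∑ w : Fin k → Fin 2, f (zeros w) =
      ∑ n ∈ Finset.range (k + 1), (k.choose n : ℝ) * f n := by
  have h : ∑ w : Fin k → Fin 2, f (zeros w) =
      ∑ s ∈ (Finset.univ : Finset (Fin k)).powerset, f s.card := by
    refine Finset.sum_bij' (fun w _ => Finset.univ.filter fun i => w i = 0)
      (fun s _ i => if i ∈ s then 0 else 1) (by simp) (by simp) ?_ ?_ (fun w _ => rfl)
    · intro w _
      funext i
      have : ∀ c : Fin 2, (if c = 0 then (0 : Fin 2) else 1) = c := by decide
      simpa using this (w i)
    · intro s _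
      ext i
      simp
  rw [h, Finset.sum_powerset_apply_card]
  simp

theorem iidSource_binary (x : ℝ) (k : ℕ) (w : Fin k → Fin 2) :
    iidSource (binary x) k w = x ^ zeros w * (1 - x) ^ (k - zeros w) := by
  have h : ∀ c : Fin 2, binary x c = if c = 0 then x else 1 - x := by
    intro c; fin_cases c <;> simp [binary]
  have hc : (Finset.univ.filter fun i => ¬ w i = 0).card = k - zeros w := by
    have := Finset.card_filter_add_card_filter_not (s := (Finset.univ : Finset (Fin k)))
      (fun i => w i = 0)
    rw [Finset.card_univ, Fintype.card_fin] at this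
    unfold zeros
    omega
  simp only [iidSource, h, Finset.prod_ite, Finset.prod_const, hc]
  rfl

end Words

/-! ### Entropy and square-root sums of the conditioned and uniform laws. -/

section Conditioning

variable {A : Type*} [Fintype A] {μ : Source A} {H ε : ℝ} {k : ℕ}

theorem conditionedSource_nonneg (h0 : ∀ k w, 0 ≤ μ k w) (k : ℕ) (w : Fin k → A) :
    0 ≤ conditionedSource μ H ε k w := by
  unfold conditionedSource
  split_ifs
  · exact div_nonneg (h0 k w) (Finset.sum_nonneg fun v _ => h0 k v)
  · exact le_rfl

theorem uniformSource_nonneg (k : ℕ) (w : Fin k → A) : 0 ≤ uniformSource μ H ε k w := by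
  unfold uniformSource
  split_ifs <;> positivity

/-- A sum over all words of a function of the conditioned law only sees the typical set. -/
theorem sum_conditionedSource (f : ℝ → ℝ) (hf : f 0 = 0) :
    ∑ w, f (conditionedSource μ H ε k w) =
      ∑ w ∈ typicalSet μ H ε k, f (μ k w / ∑ v ∈ typicalSet μ H ε k, μ k v) := by
  classical
  simp only [conditionedSource, apply_ite f, hf, Finset.sum_ite_mem, Finset.univ_inter]

theorem sum_uniformSource (f : ℝ → ℝ) (hf : f 0 = 0) :
    ∑ w, f (uniformSource μ H ε k w) =
      (typicalSet μ H ε k).card * f (1 / (typicalSet μ H ε k).card) := by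
  classical
  simp only [uniformSource, apply_ite f, hf, Finset.sum_ite_mem, Finset.univ_inter,
    Finset.sum_const, nsmul_eq_mul]

theorem sum_conditionedSource_eq_one (hs : 0 < ∑ w ∈ typicalSet μ H ε k, μ k w) :
    ∑ w, conditionedSource μ H ε k w = 1 := by
  rw [sum_conditionedSource (fun x => x) rfl, ← Finset.sum_div, div_self hs.ne']

theorem sum_uniformSource_eq_one (hs : 0 < ((typicalSet μ H ε k).card : ℝ)) :
    ∑ w, uniformSource μ H ε k w = 1 := by
  rw [sum_uniformSource (fun x => x) rfl, mul_one_div, div_self hs.ne']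

theorem entropy_conditionedSource (h0 : ∀ w, 0 < μ k w)
    (hs : 0 < ∑ w ∈ typicalSet μ H ε k, μ k w) :
    ∑ w, conditionedSource μ H ε k w * Real.log (conditionedSource μ H ε k w) =
      (∑ w ∈ typicalSet μ H ε k, μ k w * Real.log (μ k w)) /
        (∑ w ∈ typicalSet μ H ε k, μ k w) -
      Real.log (∑ w ∈ typicalSet μ H ε k, μ k w) := by
  rw [sum_conditionedSource (fun x => x * Real.log x) (by simp)]
  set s := ∑ w ∈ typicalSet μ H ε k, μ k w with hsdef
  have : ∀ w, μ k w / s * Real.log (μ k w / s) =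
      μ k w * Real.log (μ k w) / s - μ k w * (Real.log s / s) := by
    intro w
    rw [Real.log_div (h0 w).ne' hs.ne']
    ring
  simp only [this, Finset.sum_sub_distrib, ← Finset.sum_div, ← Finset.sum_mul, ← hsdef]
  rw [mul_div_cancel₀ _ hs.ne']

theorem entropy_uniformSource (hs : 0 < ((typicalSet μ H ε k).card : ℝ)) :
    ∑ w, uniformSource μ H ε k w * Real.log (uniformSource μ H ε k w) =
      -Real.log (typicalSet μ H ε k).card := by
  rw [sum_uniformSource (fun x => x * Real.log x) (by simp), ← mul_assoc, mul_one_div,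
    div_self hs.ne', one_mul, one_div, Real.log_inv]

theorem sum_sqrt_conditionedSource (hs : 0 ≤ ∑ w ∈ typicalSet μ H ε k, μ k w) :
    ∑ w, √(conditionedSource μ H ε k w) =
      (∑ w ∈ typicalSet μ H ε k, √(μ k w)) / √(∑ w ∈ typicalSet μ H ε k, μ k w) := by
  rw [sum_conditionedSource Real.sqrt Real.sqrt_zero, Finset.sum_div]
  exact Finset.sum_congr rfl fun w _ => Real.sqrt_div' _ hs

theorem sq_sum_sqrt_uniformSource :
    (∑ w, √(uniformSource μ H ε k w)) ^ 2 = (typicalSet μ H ε k).card := by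
  rw [sum_uniformSource Real.sqrt Real.sqrt_zero, mul_pow, Real.sq_sqrt (by positivity)]
  rcases (typicalSet μ H ε k).card.eq_zero_or_pos with h | h
  · simp [h]
  · have : ((typicalSet μ H ε k).card : ℝ) ≠ 0 := by positivity
    field_simp

end Conditioning

/-! ### Entropy and relative entropy on the binary simplex. -/

section Binary

theorem sum_binary_mul (x : ℝ) (f : Fin 2 → ℝ) :
    ∑ a, binary x a * f a = x * f 0 + (1 - x) * f 1 := by
  simp [binary]

theorem entropy_binary (x : ℝ) : entropy (binary x) = Real.binEntropy x := by
  rw [entropy, sum_binary_mul, binEntropy_eq_log]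
  simp [binary]

/-- The logarithms of `l` cancel, leaving a linear function of `l`; this is why the constraints
defining l⁻ and l⁺ can be solved in closed form. -/
theorem entropy_add_relEntropy {A : Type*} [Fintype A] {p : A → ℝ} (hp : ∀ a, p a ≠ 0)
    (l : A → ℝ) : entropy l + relEntropy l p = -∑ a, l a * Real.log (p a) := by
  rw [entropy, relEntropy, ← neg_add, ← Finset.sum_add_distrib]
  congr 1
  refine Finset.sum_congr rfl fun a _ => ?_
  by_cases h : l a = 0
  · simp [h]
  · rw [Real.log_div (hp a) h]; ring

theorem binary_ne_zero {p : ℝ} (h0 : 0 < p) (h1 : p < 1) (a : Fin 2) : binary p a ≠ 0 := by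
  have : 1 - p ≠ 0 := by linarith
  fin_cases a <;> simp [binary, h0.ne', this]

theorem relEntropy_binary {p : ℝ} (h0 : 0 < p) (h1 : p < 1) (x : ℝ) :
    relEntropy (binary x) (binary p) =
      -Real.binEntropy x - x * Real.log p - (1 - x) * Real.log (1 - p) := by
  have h := entropy_add_relEntropy (binary_ne_zero h0 h1) (binary x)
  rw [entropy_binary, sum_binary_mul] at h
  simp only [binary, Matrix.cons_val_zero, Matrix.cons_val_one] at h ⊢
  linarith

theorem relEntropy_binary_pos {p x : ℝ} (h0 : 0 < p) (h1 : p < 1) (hx0 : 0 < x) (hx1 : x < 1)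
    (hxp : x ≠ p) : 0 < relEntropy (binary x) (binary p) := by
  have hx1' : 0 < 1 - x := by linarith
  have h1' : 0 < 1 - p := by linarith
  rw [relEntropy_binary h0 h1, binEntropy_eq_log]
  have e1 := Real.log_lt_sub_one_of_pos (div_pos h0 hx0)
    (by rw [Ne, div_eq_one_iff_eq hx0.ne']; exact hxp.symm)
  have e2 := Real.log_le_sub_one_of_pos (div_pos h1' hx1')
  rw [Real.log_div h0.ne' hx0.ne'] at e1
  rw [Real.log_div h1'.ne' hx1'.ne'] at e2
  have f1 := mul_lt_mul_of_pos_left e1 hx0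
  have f2 := mul_le_mul_of_nonneg_left e2 hx1'.le
  rw [mul_sub x (p / x), mul_div_cancel₀ _ hx0.ne'] at f1
  rw [mul_sub (1 - x) ((1 - p) / (1 - x)), mul_div_cancel₀ _ hx1'.ne'] at f2
  linarith

theorem binary_mem_stdSimplex {x : ℝ} (h0 : 0 ≤ x) (h1 : x ≤ 1) :
    binary x ∈ stdSimplex ℝ (Fin 2) := by
  refine ⟨fun a => ?_, by simp [binary]⟩
  fin_cases a <;> simp [binary, h0, h1]

theorem eq_binary_of_mem_stdSimplex {l : Fin 2 → ℝ} (hl : l ∈ stdSimplex ℝ (Fin 2)) :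
    l = binary (l 0) := by
  have h := hl.2
  rw [Fin.sum_univ_two] at h
  funext a
  fin_cases a
  · simp [binary]
  · simp only [binary, Fin.mk_one, Matrix.cons_val_one, Matrix.cons_val_fin_one]
    linarith

/-- A level set of `h(l) + D(l‖p)` on the binary simplex is a single point. -/
theorem mem_level_iff {p e : ℝ} (h0 : 1 / 2 < p) (h1 : p < 1)
    (hx0 : 0 ≤ p - e / (Real.log p - Real.log (1 - p)))
    (hx1 : p - e / (Real.log p - Real.log (1 - p)) ≤ 1) (l : Fin 2 → ℝ) :
    (l ∈ stdSimplex ℝ (Fin 2) ∧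
      entropy l + relEntropy l (binary p) - e = entropy (binary p)) ↔
    l = binary (p - e / (Real.log p - Real.log (1 - p))) := by
  have hc : 0 < Real.log p - Real.log (1 - p) :=
    sub_pos.2 (Real.log_lt_log (by linarith) (by linarith))
  have key : ∀ x, entropy (binary x) + relEntropy (binary x) (binary p) - e =
      entropy (binary p) ↔ x = p - e / (Real.log p - Real.log (1 - p)) := by
    intro x
    rw [relEntropy_binary (by linarith) h1, entropy_binary, entropy_binary,
      binEntropy_eq_log p, eq_sub_iff_add_eq, ← eq_sub_iff_add_eq', div_eq_iff hc.ne']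
    constructor <;> intro h <;> linarith
  constructor
  · rintro ⟨hl, he⟩
    rw [eq_binary_of_mem_stdSimplex hl] at he ⊢
    rw [(key _).1 he]
  · rintro rfl
    exact ⟨binary_mem_stdSimplex hx0 hx1, (key _).2 rfl⟩

theorem isMaxOn_level_iff {A : Type*} [Fintype A] {f : (A → ℝ) → ℝ} {s : Set (A → ℝ)}
    {m : A → ℝ} (hs : ∀ l, l ∈ s ↔ l = m) (l : A → ℝ) : (l ∈ s ∧ IsMaxOn f s l) ↔ l = m := by
  refine ⟨fun h => (hs l).1 h.1, fun h => ⟨(hs l).2 h, fun l' hl' => ?_⟩⟩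
  rw [(hs l').1 hl', h]
  exact le_rfl (a := f m)

end Binary

/-! ### The typical set of the binary i.i.d. source. -/

section IidBinary

variable {p ε : ℝ} {k : ℕ}

theorem iidSource_binary_pos (h0 : 0 < p) (h1 : p < 1) (k : ℕ) (w : Fin k → Fin 2) :
    0 < iidSource (binary p) k w := by
  rw [iidSource_binary]
  have : 0 < 1 - p := by linarith
  positivity

theorem log_iidSource_binary (h0 : 0 < p) (h1 : p < 1) (w : Fin k → Fin 2) :
    Real.log (iidSource (binary p) k w) =
      zeros w * (Real.log p - Real.log (1 - p)) + k * Real.log (1 - p) := by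
  have h1' : 0 < 1 - p := by linarith
  rw [iidSource_binary, Real.log_mul (by positivity) (by positivity), Real.log_pow, Real.log_pow,
    Nat.cast_sub (zeros_le w)]
  ring

theorem sum_iidSource_binary (p : ℝ) (k : ℕ) : ∑ w, iidSource (binary p) k w = 1 := by
  simp only [iidSource_binary]
  rw [sum_words k fun n => p ^ n * (1 - p) ^ (k - n), sum_choose_mul_pow]

theorem sum_iidSource_binary_mul_zeros (p : ℝ) (k : ℕ) :
    ∑ w, iidSource (binary p) k w * zeros w = k * p := by
  simp only [iidSource_binary]
  rw [sum_words k fun n => p ^ n * (1 - p) ^ (k - n) * n, sum_choose_mul_pow_mul]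

theorem sum_iidSource_binary_mul_sq (p : ℝ) (k : ℕ) :
    ∑ w, iidSource (binary p) k w * (k * p - zeros w) ^ 2 = k * p * (1 - p) := by
  simp only [iidSource_binary]
  rw [sum_words k fun n => p ^ n * (1 - p) ^ (k - n) * (k * p - n) ^ 2,
    sum_choose_mul_pow_mul_sq]

theorem sum_iidSource_binary_mul_log (h0 : 0 < p) (h1 : p < 1) (k : ℕ) :
    ∑ w, iidSource (binary p) k w * Real.log (iidSource (binary p) k w) =
      -(k * entropy (binary p)) := by
  have : ∀ w : Fin k → Fin 2,
      iidSource (binary p) k w * Real.log (iidSource (binary p) k w) =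
        iidSource (binary p) k w * zeros w * (Real.log p - Real.log (1 - p)) +
          iidSource (binary p) k w * (k * Real.log (1 - p)) := by
    intro w
    rw [log_iidSource_binary h0 h1]
    ring
  simp only [this, Finset.sum_add_distrib, ← Finset.sum_mul, sum_iidSource_binary,
    sum_iidSource_binary_mul_zeros, entropy_binary, binEntropy_eq_log]
  ring

theorem hasSpecificEntropy_iidSource_binary (h0 : 0 < p) (h1 : p < 1) :
    HasSpecificEntropy (iidSource (binary p)) (entropy (binary p)) := by
  refine tendsto_const_nhds.congr' ?_
  filter_upwards [eventually_gt_atTop 0] with k hk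
  have : (k : ℝ) ≠ 0 := by positivity
  rw [sum_iidSource_binary_mul_log h0 h1]
  field_simp

/-- The log-probability is affine in the number of zeros, with slope log p - log(1 - p) > 0, so both
bounds become bounds on that number. -/
theorem mem_typicalSet_binary (h0 : 1 / 2 < p) (h1 : p < 1) (w : Fin k → Fin 2) :
    w ∈ typicalSet (iidSource (binary p)) (entropy (binary p)) ε k ↔
      k * (p - ε / (Real.log p - Real.log (1 - p))) ≤ zeros w ∧
        zeros w ≤ k * (p + ε / (Real.log p - Real.log (1 - p))) := by
  have h0' : 0 < p := by linarith
  have hc : 0 < Real.log p - Real.log (1 - p) :=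
    sub_pos.2 (Real.log_lt_log (by linarith) (by linarith))
  have hP := iidSource_binary_pos h0' h1 k w
  set c := Real.log p - Real.log (1 - p) with hcdef
  have e1 : (k * (p - ε / c) ≤ zeros w) ↔ k * (p - ε / c) * c ≤ zeros w * c :=
    (mul_le_mul_iff_left₀ hc).symm
  have e2 : (zeros w ≤ k * (p + ε / c)) ↔ zeros w * c ≤ k * (p + ε / c) * c :=
    (mul_le_mul_iff_left₀ hc).symm
  have e3 : k * (p - ε / c) * c = k * (p * c - ε) := by field_simp
  have e4 : k * (p + ε / c) * c = k * (p * c + ε) := by field_simp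
  simp only [typicalSet, Finset.mem_filter, Finset.mem_univ, true_and]
  rw [e1, e2, e3, e4, ← Real.le_log_iff_exp_le hP, ← Real.log_le_iff_le_exp hP,
    log_iidSource_binary h0' h1, ← hcdef, entropy_binary, binEntropy_eq_log,
    show p * Real.log p + (1 - p) * Real.log (1 - p) = p * c + Real.log (1 - p) by
      rw [hcdef]; ring]
  constructor <;> rintro ⟨h, h'⟩ <;> constructor <;> linarith

open Classical in
theorem sum_typicalSet_binary (h0 : 1 / 2 < p) (h1 : p < 1) (f : ℕ → ℝ) :
    ∑ w ∈ typicalSet (iidSource (binary p)) (entropy (binary p)) ε k, f (zeros w) =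
      ∑ n ∈ Finset.range (k + 1), (k.choose n : ℝ) *
        (if k * (p - ε / (Real.log p - Real.log (1 - p))) ≤ n ∧
          n ≤ k * (p + ε / (Real.log p - Real.log (1 - p))) then f n else 0) := by
  rw [← sum_words k fun n => if k * (p - ε / (Real.log p - Real.log (1 - p))) ≤ n ∧
    n ≤ k * (p + ε / (Real.log p - Real.log (1 - p))) then f n else 0, ← Finset.sum_filter]
  refine Finset.sum_congr ?_ fun _ _ => rfl
  ext w
  rw [mem_typicalSet_binary h0 h1]
  simp

/-- The typical set has asymptotically full probability. -/
theorem tendsto_sum_typicalSet_binary (h0 : 1 / 2 < p) (h1 : p < 1) (hε : 0 < ε) :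
    Tendsto (fun k => ∑ w ∈ typicalSet (iidSource (binary p)) (entropy (binary p)) ε k,
      iidSource (binary p) k w) atTop (𝓝 1) := by
  classical
  have h0' : 0 < p := by linarith
  have hc : 0 < Real.log p - Real.log (1 - p) :=
    sub_pos.2 (Real.log_lt_log (by linarith) (by linarith))
  set d := ε / (Real.log p - Real.log (1 - p)) with hd
  have hd0 : 0 < d := div_pos hε hc
  have hlim : Tendsto (fun k : ℕ => 1 - p * (1 - p) / d ^ 2 * (1 / (k : ℝ))) atTop
      (𝓝 (1 - p * (1 - p) / d ^ 2 * 0)) :=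
    (tendsto_one_div_atTop_nhds_zero_nat.const_mul _).const_sub 1
  rw [mul_zero, sub_zero] at hlim
  refine tendsto_of_tendsto_of_tendsto_of_le_of_le' hlim tendsto_const_nhds ?_ ?_
  · filter_upwards [eventually_gt_atTop 0] with k hk
    have hk' : (0 : ℝ) < k := by exact_mod_cast hk
    set T := typicalSet (iidSource (binary p)) (entropy (binary p)) ε k with hT
    -- Chebyshev: off the typical set the number of zeros deviates from kp by more than kd.
    have h2 : ∑ w ∈ Tᶜ, iidSource (binary p) k w ≤
        ∑ w, iidSource (binary p) k w * (k * p - zeros w) ^ 2 / (k * d) ^ 2 := by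
      refine (Finset.sum_le_sum fun w hw => ?_).trans
        (Finset.sum_le_sum_of_subset_of_nonneg (Finset.subset_univ Tᶜ) fun w _ _ =>
          div_nonneg (mul_nonneg (iidSource_binary_pos h0' h1 k w).le (sq_nonneg _))
            (sq_nonneg _))
      rw [Finset.mem_compl, hT, mem_typicalSet_binary h0 h1, ← hd, not_and_or, not_le,
        not_le] at hw
      rw [mul_div_assoc]
      refine le_mul_of_one_le_right (iidSource_binary_pos h0' h1 k w).le ?_
      rw [one_le_div (by positivity), sq_le_sq, abs_of_pos (by positivity)]
      rcases hw with hw | hw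
      · exact le_trans (by linarith) (le_abs_self _)
      · exact le_trans (by linarith) (neg_le_abs _)
    rw [← Finset.sum_div, sum_iidSource_binary_mul_sq] at h2
    have h3 := Finset.sum_add_sum_compl T (iidSource (binary p) k)
    rw [sum_iidSource_binary] at h3
    have h4 : k * p * (1 - p) / (k * d) ^ 2 = p * (1 - p) / d ^ 2 * (1 / (k : ℝ)) := by
      field_simp
    linarith
  · refine Eventually.of_forall fun k => ?_
    rw [← sum_iidSource_binary p k]
    exact Finset.sum_le_sum_of_subset_of_nonneg (Finset.subset_univ _) fun w _ _ =>
      (iidSource_binary_pos h0' h1 k w).le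

/-- The entropy of the source is carried by the typical set. -/
theorem tendsto_sum_typicalSet_mul_log (h0 : 1 / 2 < p) (h1 : p < 1) (hε : 0 < ε) :
    Tendsto (fun k : ℕ => -((1 / (k : ℝ)) *
      ∑ w ∈ typicalSet (iidSource (binary p)) (entropy (binary p)) ε k,
        iidSource (binary p) k w * Real.log (iidSource (binary p) k w))) atTop
      (𝓝 (entropy (binary p))) := by
  classical
  have h0' : 0 < p := by linarith
  have hc : 0 < Real.log p - Real.log (1 - p) :=
    sub_pos.2 (Real.log_lt_log (by linarith) (by linarith))
  have hs := tendsto_sum_typicalSet_binary h0 h1 hε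
  have hlim := ((hs.const_sub 1).mul_const (Real.log (1 - p))).const_add (entropy (binary p))
  rw [sub_self, zero_mul, add_zero] at hlim
  have hlogle : ∀ (k : ℕ) (w : Fin k → Fin 2),
      iidSource (binary p) k w * Real.log (iidSource (binary p) k w) ≤ 0 := by
    intro k w
    refine mul_nonpos_of_nonneg_of_nonpos (iidSource_binary_pos h0' h1 k w).le
      (Real.log_nonpos (iidSource_binary_pos h0' h1 k w).le ?_)
    rw [← sum_iidSource_binary p k]
    exact Finset.single_le_sum (fun w _ => (iidSource_binary_pos h0' h1 k w).le)
      (Finset.mem_univ w)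
  have hsplit : ∀ k : ℕ, 0 < k → -((1 / (k : ℝ)) *
      ∑ w ∈ typicalSet (iidSource (binary p)) (entropy (binary p)) ε k,
        iidSource (binary p) k w * Real.log (iidSource (binary p) k w)) =
      entropy (binary p) + (1 / (k : ℝ)) *
        ∑ w ∈ (typicalSet (iidSource (binary p)) (entropy (binary p)) ε k)ᶜ,
          iidSource (binary p) k w * Real.log (iidSource (binary p) k w) := by
    intro k hk
    have hk' : (k : ℝ) ≠ 0 := by positivity
    have h := Finset.sum_add_sum_compl
      (typicalSet (iidSource (binary p)) (entropy (binary p)) ε k)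
      fun w => iidSource (binary p) k w * Real.log (iidSource (binary p) k w)
    rw [sum_iidSource_binary_mul_log h0' h1, ← eq_sub_iff_add_eq] at h
    rw [h]
    field_simp
    ring
  refine tendsto_of_tendsto_of_tendsto_of_le_of_le' hlim tendsto_const_nhds ?_ ?_
  · filter_upwards [eventually_gt_atTop 0] with k hk
    have hk' : (0 : ℝ) < k := by exact_mod_cast hk
    rw [hsplit k hk]
    set T := typicalSet (iidSource (binary p)) (entropy (binary p)) ε k with hT
    have h3 := Finset.sum_add_sum_compl T (iidSource (binary p) k)
    rw [sum_iidSource_binary, ← eq_sub_iff_add_eq'] at h3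
    -- No word is less likely than (1 - p)^k, so the atypical words contribute to the entropy rate
    -- at most a constant times their probability.
    have h4 : ∑ w ∈ Tᶜ, iidSource (binary p) k w * (k * Real.log (1 - p)) ≤
        ∑ w ∈ Tᶜ, iidSource (binary p) k w * Real.log (iidSource (binary p) k w) := by
      refine Finset.sum_le_sum fun w _ =>
        mul_le_mul_of_nonneg_left ?_ (iidSource_binary_pos h0' h1 k w).le
      rw [log_iidSource_binary h0' h1]
      have : 0 ≤ (zeros w : ℝ) * (Real.log p - Real.log (1 - p)) := by positivity
      linarith
    rw [← Finset.sum_mul, h3] at h4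
    have h5 := mul_le_mul_of_nonneg_left h4 (one_div_nonneg.2 hk'.le)
    have h6 : 1 / (k : ℝ) * ((1 - ∑ w ∈ T, iidSource (binary p) k w) *
        (k * Real.log (1 - p))) =
        (1 - ∑ w ∈ T, iidSource (binary p) k w) * Real.log (1 - p) := by
      field_simp
    linarith
  · filter_upwards [eventually_gt_atTop 0] with k hk
    rw [hsplit k hk]
    have h5 : (1 / (k : ℝ)) *
        ∑ w ∈ (typicalSet (iidSource (binary p)) (entropy (binary p)) ε k)ᶜ,
          iidSource (binary p) k w * Real.log (iidSource (binary p) k w) ≤ 0 :=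
      mul_nonpos_of_nonneg_of_nonpos (by positivity)
        (Finset.sum_nonpos fun w _ => hlogle k w)
    linarith

/-- Conditioning divides by the probability of the typical set and shifts the entropy by its
logarithm; that probability tends to 1. -/
theorem hasSpecificEntropy_conditionedSource (h0 : 1 / 2 < p) (h1 : p < 1) (hε : 0 < ε) :
    HasSpecificEntropy (conditionedSource (iidSource (binary p)) (entropy (binary p)) ε)
      (entropy (binary p)) := by
  have h0' : 0 < p := by linarith
  have hs := tendsto_sum_typicalSet_binary h0 h1 hε
  have hlog := tendsto_one_div_atTop_nhds_zero_nat.mul (hs.log one_ne_zero)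
  have hlim := ((tendsto_sum_typicalSet_mul_log h0 h1 hε).div hs one_ne_zero).add hlog
  rw [div_one, zero_mul, add_zero] at hlim
  refine hlim.congr' ?_
  filter_upwards [hs.eventually_const_lt one_pos] with k hk
  rw [entropy_conditionedSource (iidSource_binary_pos h0' h1 k) hk]
  simp only [Pi.div_apply]
  ring

/-- The exponential rate of the sum over the typical set of powers of the letter weights. -/
theorem typicalSet_rate {a b x : ℝ} (h0 : 1 / 2 < p) (h1 : p < 1)
    (hu : p + ε / (Real.log p - Real.log (1 - p)) ≤ 1) (ha : 0 < a) (hb : 0 < b) (hx0 : 0 < x)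
    (hxu : x < p + ε / (Real.log p - Real.log (1 - p)))
    (hlx : p - ε / (Real.log p - Real.log (1 - p)) ≤ x)
    (hs : ∀ y, p - ε / (Real.log p - Real.log (1 - p)) ≤ y →
      (y - x) * (Real.log a - Real.log b - (Real.log x - Real.log (1 - x))) ≤ 0) :
    (∀ᶠ k : ℕ in atTop,
      0 < ∑ w ∈ typicalSet (iidSource (binary p)) (entropy (binary p)) ε k,
        a ^ zeros w * b ^ (k - zeros w)) ∧
    Tendsto (fun k : ℕ => (1 / (k : ℝ)) *
      Real.log (∑ w ∈ typicalSet (iidSource (binary p)) (entropy (binary p)) ε k,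
        a ^ zeros w * b ^ (k - zeros w))) atTop
      (𝓝 (Real.binEntropy x + x * Real.log a + (1 - x) * Real.log b)) :=
  binomial_window_rate ha hb hx0 hxu hu hlx hs _ fun k =>
    sum_typicalSet_binary h0 h1 fun n => a ^ n * b ^ (k - n)

end IidBinary

end Guesswork

/-! ### Locating the dominant types and assembling the rates. -/

open Guesswork in
theorem mainTheorem4 (p₀ ε : ℝ) (hp₀ : 1 / 2 < p₀) (hp₀' : p₀ < 1) (hε : 0 < ε)
    (hε' : ε < (Real.log p₀ - Real.log (1 - p₀)) * min (p₀ - 1 / 2) (1 - p₀))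
    (p lm lp : Fin 2 → ℝ) (hp : p = binary p₀)
    (hlm : lm = binary (p₀ - ε / (Real.log p₀ - Real.log (1 - p₀))))
    (hlp : lp = binary (p₀ + ε / (Real.log p₀ - Real.log (1 - p₀))))
    (W Wε Uε : Source (Fin 2)) (hW : W = iidSource p)
    (hWε : Wε = conditionedSource W (entropy p) ε)
    (hUε : Uε = uniformSource W (entropy p) ε)
    (Λ : ℝ)
    (hΛ : Λ = if eta p 1 ≤ entropy p + ε
      then 2 * Real.log (p₀ ^ (1 / 2 : ℝ) + (1 - p₀) ^ (1 / 2 : ℝ))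
      else entropy lm - relEntropy lm p)
    (GW GU : (k : ℕ) → (Fin k → Fin 2) → ℕ)
    (hGW : ∀ k, IsGuesswork (Wε k) (GW k)) (hGU : ∀ k, IsGuesswork (Uε k) (GU k)) :
    -- the typical set is the one of the source, and conditioning on it makes sense
    HasSpecificEntropy W (entropy p) ∧
    (∀ᶠ k in atTop, 0 < ∑ w ∈ typicalSet W (entropy p) ε k, W k w) ∧
    -- closed forms
    (∀ l, IsLMinus p ε l ↔ l = lm) ∧ (∀ l, IsLPlus p ε l ↔ l = lp) ∧
    (1 / 2 < lm 0 ∧ lm 0 < p₀ ∧ p₀ < lp 0 ∧ lp 0 < 1) ∧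
    -- growth rates of the expected Guesswork, and their strict order
    HasGuessworkRate Uε GU (entropy lm) ∧
    HasSCGF Wε GW 1 Λ ∧ HasGuessworkRate Wε GW Λ ∧
    Λ < entropy lm ∧
    -- growth rates of the expected logarithm of the Guesswork, and their strict order
    HasLogGuessworkRate Uε GU (entropy lm) ∧
    HasLogGuessworkRate Wε GW (entropy p) ∧
    entropy p < entropy lm := by
  have hp0 : 0 < p₀ := by linarith
  have hq0 : 0 < 1 - p₀ := by linarith
  have hc : 0 < Real.log p₀ - Real.log (1 - p₀) :=
    sub_pos.2 (Real.log_lt_log hq0 (by linarith))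
  have hd0 : 0 < ε / (Real.log p₀ - Real.log (1 - p₀)) := div_pos hε hc
  have hd1 : ε / (Real.log p₀ - Real.log (1 - p₀)) < min (p₀ - 1 / 2) (1 - p₀) := by
    rwa [div_lt_iff₀' hc]
  obtain ⟨hd2, hd3⟩ := lt_min_iff.1 hd1
  have hlevelm := mem_level_iff hp₀ hp₀' (e := ε) (by linarith) (by linarith)
  have hlevelp := mem_level_iff hp₀ hp₀' (e := -ε) (by rw [neg_div]; linarith)
    (by rw [neg_div]; linarith)
  have hprob := tendsto_sum_typicalSet_binary hp₀ hp₀' hε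
  have hprob0 := hprob.eventually_const_lt one_pos
  have hrate := fun a b x => typicalSet_rate (ε := ε) (a := a) (b := b) (x := x) hp₀ hp₀'
    (by linarith)
  set d := ε / (Real.log p₀ - Real.log (1 - p₀)) with hd
  subst hp hlm hlp hW hWε hUε
  have hpos := iidSource_binary_pos hp0 hp₀'
  have hnn := fun k w => (hpos k w).le
  -- the size of the typical set
  obtain ⟨hcard0, hcard⟩ := hrate 1 1 (p₀ - d) one_pos one_pos (by linarith) (by linarith)
    le_rfl (by
      intro y hy
      have : Real.log (1 - (p₀ - d)) ≤ Real.log (p₀ - d) :=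
        Real.log_le_log (by linarith) (by linarith)
      exact mul_nonpos_of_nonneg_of_nonpos (by linarith) (by linarith))
  simp only [one_pow, mul_one, Finset.sum_const, nsmul_eq_mul, Real.log_one, mul_zero,
    add_zero, ← entropy_binary] at hcard0 hcard
  have hanti : entropy (binary p₀) < entropy (binary (p₀ - d)) := by
    rw [entropy_binary, entropy_binary]
    exact Real.binEntropy_strictAntiOn ⟨by norm_num; linarith, by linarith⟩
      ⟨by norm_num; linarith, by linarith⟩ (by linarith)
  -- the tilted distribution
  set t := tilted (binary p₀) 1 0 with ht
  have hr0 : 0 < √p₀ := Real.sqrt_pos.2 hp0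
  have hr1 : 0 < √(1 - p₀) := Real.sqrt_pos.2 hq0
  have hlr0 : Real.log √p₀ = Real.log p₀ / 2 := Real.log_sqrt hp0.le
  have hlr1 : Real.log √(1 - p₀) = Real.log (1 - p₀) / 2 := Real.log_sqrt hq0.le
  have htilt : ∀ a, tilted (binary p₀) 1 a = √(binary p₀ a) / (√p₀ + √(1 - p₀)) := by
    intro a
    have : (1 : ℝ) / (1 + 1) = 1 / 2 := by norm_num
    simp only [tilted, this, ← Real.sqrt_eq_rpow, Fin.sum_univ_two]
    simp [binary]
  have ht0 : t = √p₀ / (√p₀ + √(1 - p₀)) := by rw [ht, htilt]; simp [binary]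
  have ht1 : 1 - t = √(1 - p₀) / (√p₀ + √(1 - p₀)) := by rw [ht0]; field_simp; ring
  have ht1' : tilted (binary p₀) 1 1 = 1 - t := by rw [ht1, htilt]; simp [binary]
  have htpos : 0 < t := by rw [ht0]; positivity
  have htlt : 0 < 1 - t := by rw [ht1]; positivity
  have hlt0 : Real.log t = Real.log p₀ / 2 - Real.log (√p₀ + √(1 - p₀)) := by
    rw [ht0, Real.log_div hr0.ne' (by positivity), hlr0]
  have hlt1 : Real.log (1 - t) = Real.log (1 - p₀) / 2 - Real.log (√p₀ + √(1 - p₀)) := by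
    rw [ht1, Real.log_div hr1.ne' (by positivity), hlr1]
  -- If t ≥ p₀, comparing logarithms of t with p₀ and of 1 - t with 1 - p₀ forces log p₀ ≤ log(1 -
  -- p₀).
  have htp : t < p₀ := by
    by_contra! h
    have h2 := Real.log_le_log hp0 h
    have h3 := Real.log_le_log htlt (by linarith : 1 - t ≤ 1 - p₀)
    linarith
  have heta : eta (binary p₀) 1 ≤ entropy (binary p₀) + ε ↔ p₀ - d ≤ t := by
    have e1 : eta (binary p₀) 1 =
        -(t * (Real.log p₀ - Real.log (1 - p₀)) + Real.log (1 - p₀)) := by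
      rw [eta, Fin.sum_univ_two, ht1', ← ht]
      simp only [binary, Matrix.cons_val_zero, Matrix.cons_val_one, Matrix.cons_val_fin_one]
      ring
    have e2 : p₀ - d ≤ t ↔
        (p₀ - d) * (Real.log p₀ - Real.log (1 - p₀)) ≤
          t * (Real.log p₀ - Real.log (1 - p₀)) := (mul_le_mul_iff_left₀ hc).symm
    have e3 : d * (Real.log p₀ - Real.log (1 - p₀)) = ε := div_mul_cancel₀ _ hc.ne'
    rw [e1, e2, sub_mul, e3, entropy_binary, binEntropy_eq_log]
    constructor <;> intro h <;> linarith
  -- the dominant type for the conditioned source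
  set x := max t (p₀ - d) with hx
  have hx0 : 0 < x := htpos.trans_le (le_max_left _ _)
  have hxp : x < p₀ := max_lt htp (by linarith)
  -- At x = t the log-odds of x equal log(√p₀ / √(1 - p₀)) and the bracket vanishes; at x = p₀ - d ≥
  -- t they are no smaller, so the bracket is nonpositive while y ≥ x.
  have hxs : ∀ y, p₀ - d ≤ y → (y - x) *
      (Real.log √p₀ - Real.log √(1 - p₀) - (Real.log x - Real.log (1 - x))) ≤ 0 := by
    intro y hy
    rcases le_total (p₀ - d) t with h | h
    · rw [hx, max_eq_left h, hlr0, hlr1, hlt0, hlt1]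
      exact le_of_eq (by ring)
    · rw [hx, max_eq_right h]
      have h2 := Real.log_le_log htpos h
      have h3 := Real.log_le_log (by linarith) (by linarith : 1 - (p₀ - d) ≤ 1 - t)
      exact mul_nonpos_of_nonneg_of_nonpos (by linarith) (by linarith)
  obtain ⟨hsq0, hsq⟩ := hrate √p₀ √(1 - p₀) x hr0 hr1 hx0 (by linarith) (le_max_right _ _) hxs
  have hsqrt : ∀ (k : ℕ) (w : Fin k → Fin 2),
      √p₀ ^ zeros w * √(1 - p₀) ^ (k - zeros w) = √(iidSource (binary p₀) k w) := by
    intro k w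
    have hpow : ∀ (y : ℝ) (n : ℕ), 0 ≤ y → √(y ^ n) = √y ^ n := fun y n hy => by
      rw [Real.sqrt_eq_iff_mul_self_eq (by positivity) (by positivity), ← mul_pow,
        Real.mul_self_sqrt hy]
    rw [iidSource_binary, Real.sqrt_mul (by positivity), hpow _ _ hp0.le, hpow _ _ hq0.le]
  simp only [hsqrt] at hsq0 hsq
  -- Both branches are one formula: at x = t, h - D collapses to 2 log(√p₀ + √(1 - p₀)).
  have hΛx : Λ = entropy (binary x) - relEntropy (binary x) (binary p₀) := by
    rw [hΛ]
    split_ifs with h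
    · rw [heta] at h
      rw [hx, max_eq_left h, relEntropy_binary hp0 hp₀', entropy_binary, binEntropy_eq_log,
        hlt0, hlt1, Real.sqrt_eq_rpow, Real.sqrt_eq_rpow]
      ring
    · rw [heta, not_le] at h
      rw [hx, max_eq_right h.le]
  -- Strictness of Λ < h(l⁻) comes from here: x ≠ p₀, so the divergence is positive.
  have hD := relEntropy_binary_pos hp0 hp₀' hx0 (by linarith) hxp.ne
  have hhx : entropy (binary x) ≤ entropy (binary (p₀ - d)) := by
    rw [entropy_binary, entropy_binary]
    exact Real.binEntropy_strictAntiOn.antitoneOn ⟨by norm_num; linarith, by linarith⟩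
      ⟨by norm_num; linarith [le_max_right t (p₀ - d)], by linarith⟩ (le_max_right _ _)
  have hWrate : HasGuessworkRate
      (conditionedSource (iidSource (binary p₀)) (entropy (binary p₀)) ε) GW Λ := by
    refine hasGuessworkRate_of_sqrt hGW (conditionedSource_nonneg hnn) ?_ ?_
    · filter_upwards [hprob0, hsq0] with k hk hk'
      rw [sum_sqrt_conditionedSource hk.le]
      positivity
    · have hlim := (hsq.const_mul 2).sub
        (tendsto_one_div_atTop_nhds_zero_nat.mul (hprob.log one_ne_zero))
      have e : 2 * (Real.binEntropy x + x * Real.log √p₀ + (1 - x) * Real.log √(1 - p₀)) -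
          0 * Real.log 1 = Λ := by
        rw [hΛx, relEntropy_binary hp0 hp₀', entropy_binary, hlr0, hlr1]
        ring
      rw [e] at hlim
      refine hlim.congr' ?_
      filter_upwards [hprob0, hsq0] with k hk hk'
      rw [sum_sqrt_conditionedSource hk.le, div_pow, Real.sq_sqrt hk.le,
        Real.log_div (by positivity) hk.ne', Real.log_pow]
      push_cast
      ring
  refine ⟨hasSpecificEntropy_iidSource_binary hp0 hp₀', hprob0, fun l => ?_, fun l => ?_,
    ?_, ?_, (hasSCGF_one_iff hGW).2 hWrate, hWrate, by linarith, ?_, ?_, hanti⟩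
  · exact isMaxOn_level_iff hlevelm l
  · rw [neg_div, sub_neg_eq_add] at hlevelp
    simp only [sub_neg_eq_add] at hlevelp
    exact isMaxOn_level_iff hlevelp l
  · simp only [binary, Matrix.cons_val_zero]
    refine ⟨?_, ?_, ?_, ?_⟩ <;> linarith
  · refine hasGuessworkRate_of_sqrt hGU uniformSource_nonneg ?_ ?_
    · filter_upwards [hcard0] with k hk
      have h2 := sq_sum_sqrt_uniformSource (μ := iidSource (binary p₀))
        (H := entropy (binary p₀)) (ε := ε) (k := k)
      refine lt_of_le_of_ne (Finset.sum_nonneg fun _ _ => Real.sqrt_nonneg _) fun h => ?_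
      rw [← h] at h2
      norm_num at h2
      rw [← h2] at hk
      simp at hk
    · simpa only [sq_sum_sqrt_uniformSource] using hcard
  · refine hasLogGuessworkRate_of_entropy hGU uniformSource_nonneg
      (hcard0.mono fun k hk => sum_uniformSource_eq_one hk) (hcard.congr' ?_)
    filter_upwards [hcard0] with k hk
    rw [entropy_uniformSource hk, mul_neg, neg_neg]
  · exact hasLogGuessworkRate_of_entropy hGW (conditionedSource_nonneg hnn)
      (hprob0.mono fun k hk => sum_conditionedSource_eq_one hk)
      (hasSpecificEntropy_conditionedSource hp₀ hp₀' hε)
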